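/- Let $n\ge 2$ be an integer and let $\mathscr C_n$ be the set of all $n$-cycles in the symmetric group of permutations of $\{1,\dots,n\}$. The degree (cyclic descent number) of a permutation $\nu$ of $\{1,\dots,n\}$ is $$\deg(\nu)=\#\{\,1\le i\le n:\ \nu(i)>\nu(i+1)\,\},$$ where $i$ is taken modulo $n$, so that $\nu(n+1)=\nu(1)$. For $d\ge 1$ let $N_{n,d}$ be the number of $\nu\in\mathscr C_n$ with $\deg(\nu)=d$, and for $k\ge 1$ let $$\Delta_n(k)=\sum_{r\mid n}\mu\Big(\frac nr\Big)\Big(\sum_{j=0}^{r-1}k^j\Big),$$ where $\mu$ is the Möbius function. Then for every $d\ge 1$, $$N_{n,d}=\sum_{i=1}^{d}(-1)^{d-i}\binom{n}{d-i}\Delta_n(i).$$ In particular, if $n\ge 3$, then the sum on the right-hand side vanishes for every $d\ge n-1$. -/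

import Mathlib

/-- The degree (cyclic descent number) of a permutation `ν` of `n` points: the number of `i` with
`ν i > ν (i + 1)`, where `i` is taken modulo `n` (`finRotate n` is the map `i ↦ i + 1` mod `n`). -/
def cycDeg {n : ℕ} (ν : Equiv.Perm (Fin n)) : ℕ :=
  (Finset.univ.filter fun i : Fin n => ν (finRotate n i) < ν i).card

/-- The `n`-cycles in the symmetric group on `n` points: a single cycle moving every point
(for `n ≥ 2`). -/
noncomputable def nCycles (n : ℕ) : Finset (Equiv.Perm (Fin n)) :=
  open Classical in Finset.univ.filter fun ν => ν.IsCycle ∧ ν.support = Finset.univ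

/-- `N_{n,d}`: the number of `n`-cycles of degree `d`. -/
noncomputable def numCyclesOfDeg (n d : ℕ) : ℕ :=
  ((nCycles n).filter fun ν => cycDeg ν = d).card

/-- `Δ_n(k) = ∑_{r ∣ n} μ(n / r) (1 + k + ⋯ + k ^ (r - 1))`. -/
def cycDelta (n k : ℕ) : ℤ :=
  ∑ r ∈ n.divisors, ArithmeticFunction.moebius (n / r) * ∑ j ∈ Finset.range r, (k : ℤ) ^ j

/-! Count the pairs (ν, f), with ν an n-cycle and f a lift of degree k, in two ways. A lift makes at
least one turn at each cyclic descent of ν and the surplus turns are arbitrary, so ν has as many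
lifts as there are functions `Fin n → ℕ` with sum k - deg ν (`liftEquivExcess`). The generating
function of the pairs is therefore (∑ X^(deg ν)) / (1 - X)^n.

On the other hand f^n(0) = n j with 0 ≤ j < M = 1 + k + ⋯ + k^(n-1). The points f^m(0) + n q are
ordered like the lifts to ℤ of the orbit of 0 under X ↦ k X + j modulo M (`IsLift.orbit_lt_iff`).
Hence j determines f, and j occurs exactly when 0 has minimal period n (`card_sigma_isLift`). Möbius
inversion over the possible periods shows that Δ_n(k) counts these j (`cycDelta_eq_primitiveCount`),
and multiplying by (1 - X)^n gives the formula.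

An n-cycle of degree at least n - 1 would, after reversal of its values, have degree at most 1 and
so be a rotation. The cycle would then be a reflection, whose square fixes a point: impossible for n
≥ 3. -/

/-! ### Residues modulo n and functions on ℤ given by their differences. -/

/-- The residue of an integer modulo `n`, as an element of `Fin n`. -/
def residue (n : ℕ) [NeZero n] (i : ℤ) : Fin n :=
  ⟨(i % n).toNat, by
    have h : (0 : ℤ) < n := by exact_mod_cast Nat.pos_of_ne_zero (NeZero.ne n)
    have := Int.emod_lt_of_pos i h
    have := Int.emod_nonneg i h.ne'
    omega⟩

section residue
variable {n : ℕ} [NeZero n]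

theorem cast_pos_of_neZero : (0 : ℤ) < n := by
  exact_mod_cast Nat.pos_of_ne_zero (NeZero.ne n)

theorem coe_residue (i : ℤ) : ((residue n i : ℕ) : ℤ) = i % n := by
  have := Int.emod_nonneg i (cast_pos_of_neZero (n := n)).ne'
  simp [residue, this]

theorem residue_eq_iff {i j : ℤ} : residue n i = residue n j ↔ i % n = j % n := by
  rw [← coe_residue, ← coe_residue, Fin.ext_iff]
  norm_cast

theorem residue_coe (x : Fin n) : residue n ((x : ℕ) : ℤ) = x := by
  have h := coe_residue (n := n) ((x : ℕ) : ℤ)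
  rw [Int.emod_eq_of_lt (by positivity) (by exact_mod_cast x.2)] at h
  exact Fin.ext (by exact_mod_cast h)

theorem residue_add_mul (i q : ℤ) : residue n (i + n * q) = residue n i := by
  rw [residue_eq_iff]; simp

theorem residue_add_self (i : ℤ) : residue n (i + n) = residue n i := by
  rw [residue_eq_iff]; simp

theorem eq_add_mul_of_residue_eq {i j : ℤ} (h : residue n i = residue n j) :
    ∃ q : ℤ, i = j + n * q := by
  rw [residue_eq_iff] at h
  obtain ⟨c, hc⟩ := (Int.ModEq.dvd (show j ≡ i [ZMOD n] from h.symm))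
  exact ⟨c, by linarith⟩

theorem finRotate_residue (i : ℤ) : finRotate n (residue n i) = residue n (i + 1) := by
  obtain ⟨m, rfl⟩ : ∃ m, n = m + 1 := Nat.exists_eq_succ_of_ne_zero (NeZero.ne n)
  have h : ((finRotate (m + 1) (residue (m + 1) i) : ℕ) : ℤ) = (residue (m + 1) (i + 1) : ℕ) := by
    rw [finRotate_apply, Fin.val_add, coe_residue]
    push_cast
    rw [coe_residue]
    push_cast
    simp
  exact Fin.ext (by exact_mod_cast h)

end residue

theorem Int.apply_eq_of_apply_succ_eq {G : ℤ → ℤ} (h : ∀ i, G (i + 1) = G i) (i : ℤ) :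
    G i = G 0 := by
  induction i with
  | zero => rfl
  | succ i ih => rw [h, ih]
  | pred i ih => rw [← ih, ← h (-(i : ℤ) - 1)]; congr 1; ring

theorem Int.exists_primitive (w : ℤ → ℤ) :
    ∃ W : ℤ → ℤ, W 0 = 0 ∧ ∀ i, W (i + 1) = W i + w i := by
  refine ⟨fun i => ∑ l ∈ Finset.range i.toNat, w l -
    ∑ l ∈ Finset.range (-i).toNat, w (-(l + 1 : ℕ)), by simp, fun i => ?_⟩
  rcases i with m | m
  · have h1 : ((m : ℤ) + 1).toNat = m + 1 := by omega
    have h2 : (-((m : ℤ) + 1)).toNat = 0 := by omega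
    have h3 : (-(m : ℤ)).toNat = 0 := by omega
    simp only [Int.ofNat_eq_natCast, h1, h2, h3, Int.toNat_natCast, Finset.sum_range_succ,
      Finset.range_zero, Finset.sum_empty, sub_zero]
  · have h1 : (Int.negSucc m + 1).toNat = 0 := by omega
    have h2 : (-(Int.negSucc m + 1)).toNat = m := by omega
    have h3 : (-(Int.negSucc m)).toNat = m + 1 := by omega
    have h4 : (Int.negSucc m).toNat = 0 := by omega
    simp only [h1, h2, h3, h4, Finset.sum_range_succ, Finset.range_zero, Finset.sum_empty]
    rw [Int.negSucc_eq]
    push_cast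
    ring

/-! ### Lifts of a fixed permutation, parametrized by their excess. -/

/-- The normalized lifts to `ℤ`, of degree `k`, of a permutation `ν` of the `n` residue classes. -/
structure IsLift (n k : ℕ) [NeZero n] (ν : Equiv.Perm (Fin n)) (f : ℤ → ℤ) : Prop where
  strictMono : StrictMono f
  map_add : ∀ i, f (i + n) = f i + k * n
  zero_nonneg : 0 ≤ f 0
  zero_lt : f 0 < n
  residue_map : ∀ i, residue n (f i) = ν (residue n i)

/-- The indicator function of the cyclic descents of `ν`. -/
def descInd {n : ℕ} (ν : Equiv.Perm (Fin n)) (x : Fin n) : ℕ :=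
  if ν (finRotate n x) < ν x then 1 else 0

theorem cycDeg_eq_sum {n : ℕ} (ν : Equiv.Perm (Fin n)) : cycDeg ν = ∑ x, descInd ν x :=
  Finset.card_filter _ _

/-- The number of turns made by `f` on the gap between `i` and `i + 1`. -/
def turns (n : ℕ) (f : ℤ → ℤ) (i : ℤ) : ℤ := f (i + 1) / n - f i / n

section lift
variable {n k : ℕ} [NeZero n] {ν : Equiv.Perm (Fin n)} {f : ℤ → ℤ}

theorem residue_succ_ne (hn : 2 ≤ n) (i : ℤ) : residue n (i + 1) ≠ residue n i := by
  intro h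
  obtain ⟨q, hq⟩ := eq_add_mul_of_residue_eq h
  have h1 : (n : ℤ) * q = 1 := by linarith
  have := Int.eq_one_or_neg_one_of_mul_eq_one h1
  omega

/-- An integer-valued function with prescribed residues increases along the step `i → i + 1` if
and only if its quotient increases by at least the descent indicator. -/
theorem lt_succ_iff_descInd_le (hn : 2 ≤ n) (hf : ∀ i, residue n (f i) = ν (residue n i)) (i : ℤ) :
    f i < f (i + 1) ↔ (descInd ν (residue n i) : ℤ) ≤ turns n f i := by
  have hpos : (0 : ℤ) < n := cast_pos_of_neZero
  have h0 := coe_residue (n := n) (f i)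
  have h1 := coe_residue (n := n) (f (i + 1))
  rw [hf] at h0 h1
  have hne : ν (residue n (i + 1)) ≠ ν (residue n i) := fun h =>
    residue_succ_ne hn i (ν.injective h)
  have hne' : ((ν (residue n (i + 1)) : ℕ) : ℤ) ≠ (ν (residue n i) : ℕ) := by
    intro h; exact hne (Fin.ext (by exact_mod_cast h))
  have e0 := Int.mul_ediv_add_emod (f i) n
  have e1 := Int.mul_ediv_add_emod (f (i + 1)) n
  have b0 := (ν (residue n i)).2
  have b1 := (ν (residue n (i + 1))).2
  unfold turns descInd
  simp only [finRotate_residue, Fin.lt_def]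
  rw [← h0] at e0
  rw [← h1] at e1
  generalize (ν (residue n i) : ℕ) = u at *
  generalize (ν (residue n (i + 1)) : ℕ) = v at *
  generalize f i / (n : ℤ) = A at *
  generalize f (i + 1) / (n : ℤ) = B at *
  rw [← e0, ← e1]
  have key : (n : ℤ) * B - n * A = n * (B - A) := by ring
  generalize B - A = t at *
  -- As 0 < |v - u| < n, the sign of v - u + n t is that of t, unless t = 0; these bounds make the
  -- nonlinear term n t accessible to `omega`.
  have c1 : 1 ≤ t → (n : ℤ) ≤ n * t := fun h => by nlinarith
  have c2 : t ≤ -1 → (n : ℤ) * t ≤ -n := fun h => by nlinarith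
  have c3 : t = 0 → (n : ℤ) * t = 0 := fun h => by simp [h]
  split_ifs with hlt
  · rcases lt_trichotomy t 0 with h | h | h
    · have := c2 (by omega); push_cast; omega
    · have := c3 h; push_cast; omega
    · have := c1 (by omega); push_cast; omega
  · rcases lt_trichotomy t 0 with h | h | h
    · have := c2 (by omega); push_cast; omega
    · have := c3 h; push_cast; omega
    · have := c1 (by omega); push_cast; omega

theorem IsLift.turns_periodic (hf : IsLift n k ν f) (i : ℤ) : turns n f (i + n) = turns n f i := by
  have hpos : (n : ℤ) ≠ 0 := (cast_pos_of_neZero (n := n)).ne'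
  unfold turns
  rw [show i + n + 1 = (i + 1) + n by ring, hf.map_add, hf.map_add,
    Int.add_mul_ediv_right _ _ hpos, Int.add_mul_ediv_right _ _ hpos]
  ring

theorem apply_residue_of_periodic {w : ℤ → ℤ} (hw : ∀ i, w (i + n) = w i) (i : ℤ) :
    w (residue n i : ℕ) = w i := by
  have h : Function.Periodic w (n : ℤ) := hw
  have := h.int_mul (i / n) (i % n)
  rw [coe_residue]
  rw [← this]
  congr 1
  have := Int.mul_ediv_add_emod i n
  simp only [Int.cast_id] at *
  linarith

theorem IsLift.sum_turns (hf : IsLift n k ν f) : ∑ x : Fin n, turns n f (x : ℕ) = k := by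
  have hpos : (n : ℤ) ≠ 0 := (cast_pos_of_neZero (n := n)).ne'
  rw [Fin.sum_univ_eq_sum_range (fun l => turns n f (l : ℤ))]
  have h := Finset.sum_range_sub (fun l : ℕ => f (l : ℤ) / (n : ℤ)) n
  have e := hf.map_add 0
  rw [zero_add] at e
  simp only [e, Nat.cast_zero, Int.add_mul_ediv_right _ _ hpos, add_sub_cancel_left] at h
  simpa [turns] using h

theorem IsLift.descInd_le_turns (hn : 2 ≤ n) (hf : IsLift n k ν f) (x : Fin n) :
    (descInd ν x : ℤ) ≤ turns n f (x : ℕ) := by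
  have h := (lt_succ_iff_descInd_le hn hf.residue_map (x : ℕ)).1 (hf.strictMono (by omega))
  rwa [residue_coe] at h

/-- The excess of the turns of a lift over the descents of the permutation. -/
def excess (ν : Equiv.Perm (Fin n)) (f : ℤ → ℤ) (x : Fin n) : ℕ :=
  (turns n f (x : ℕ) - descInd ν x).toNat

theorem IsLift.coe_excess (hn : 2 ≤ n) (hf : IsLift n k ν f) (x : Fin n) :
    (excess ν f x : ℤ) = turns n f (x : ℕ) - descInd ν x := by
  have := hf.descInd_le_turns hn x
  unfold excess
  omega

theorem IsLift.sum_excess (hn : 2 ≤ n) (hf : IsLift n k ν f) :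
    ∑ x, excess ν f x + cycDeg ν = k := by
  have h := hf.sum_turns
  have : ((∑ x, excess ν f x + cycDeg ν : ℕ) : ℤ) = k := by
    rw [cycDeg_eq_sum, ← h]
    push_cast
    rw [← Finset.sum_add_distrib]
    refine Finset.sum_congr rfl fun x _ => ?_
    rw [hf.coe_excess hn]
    ring
  exact_mod_cast this

/-- The excess fixes the differences of the quotients f i / n, the normalization 0 ≤ f 0 < n fixes
their constant, and ν fixes the remainders. -/
theorem IsLift.ext_of_excess (hn : 2 ≤ n) {g : ℤ → ℤ} (hf : IsLift n k ν f) (hg : IsLift n k ν g)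
    (h : excess ν f = excess ν g) : f = g := by
  have ht : ∀ i, turns n f i = turns n g i := fun i => by
    rw [← apply_residue_of_periodic hf.turns_periodic i,
      ← apply_residue_of_periodic hg.turns_periodic i]
    have h1 := hf.coe_excess hn (residue n i)
    have h2 := hg.coe_excess hn (residue n i)
    rw [h] at h1
    linarith
  have hq : ∀ i, f i / n = g i / n := fun i => by
    have := Int.apply_eq_of_apply_succ_eq (G := fun i => f i / n - g i / n) (fun i => by
      have := ht i
      unfold turns at this
      linarith) i
    rw [Int.ediv_eq_zero_of_lt hf.zero_nonneg hf.zero_lt,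
      Int.ediv_eq_zero_of_lt hg.zero_nonneg hg.zero_lt] at this
    linarith
  funext i
  have h1 : f i % n = g i % n := by
    rw [← residue_eq_iff, hf.residue_map, hg.residue_map]
  rw [← Int.mul_ediv_add_emod (f i) n, ← Int.mul_ediv_add_emod (g i) n, hq, h1]

theorem exists_isLift_of_excess (hn : 2 ≤ n) (ν : Equiv.Perm (Fin n)) (a : Fin n → ℕ)
    (ha : ∑ x, a x + cycDeg ν = k) : ∃ f, IsLift n k ν f ∧ excess ν f = a := by
  have hpos : (0 : ℤ) < n := cast_pos_of_neZero
  obtain ⟨W, hW0, hW⟩ := Int.exists_primitive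
    (fun i => (a (residue n i) : ℤ) + descInd ν (residue n i))
  have hWn : W n = k := by
    have h := Finset.sum_range_sub (fun l : ℕ => W l) n
    simp only [Nat.cast_add, Nat.cast_one, hW, Nat.cast_zero, hW0, sub_zero,
      add_sub_cancel_left] at h
    rw [← h, ← Fin.sum_univ_eq_sum_range
      (fun l => (a (residue n l) : ℤ) + descInd ν (residue n l))]
    simp only [residue_coe]
    rw [cycDeg_eq_sum, ← Finset.sum_add_distrib] at ha
    exact_mod_cast ha
  have hWp : ∀ i, W (i + n) = W i + k := fun i => by
    have := Int.apply_eq_of_apply_succ_eq (G := fun i => W (i + n) - W i) (fun i => by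
      rw [show i + 1 + (n : ℤ) = (i + n) + 1 by ring, hW, hW, residue_add_self]
      ring) i
    simp only [zero_add, hWn, hW0] at this
    linarith
  -- The remainder is prescribed by ν, and the quotient W is the running sum of the required turns.
  set f : ℤ → ℤ := fun i => (ν (residue n i) : ℕ) + n * W i with hfdef
  have hlt : ∀ x : Fin n, ((x : ℕ) : ℤ) < n := fun x => by exact_mod_cast x.2
  have hdiv : ∀ i, f i / n = W i := fun i => by
    rw [hfdef]
    simp only
    rw [Int.add_mul_ediv_left _ _ hpos.ne', Int.ediv_eq_zero_of_lt (by positivity) (hlt _),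
      zero_add]
  have hturns : ∀ i, turns n f i = a (residue n i) + descInd ν (residue n i) := fun i => by
    rw [turns, hdiv, hdiv, hW]; ring
  have hres : ∀ i, residue n (f i) = ν (residue n i) := fun i => by
    rw [hfdef]
    simp only
    rw [residue_add_mul, residue_coe]
  refine ⟨f, ⟨strictMono_int_of_lt_succ fun i => ?_, fun i => ?_, ?_, ?_, hres⟩, ?_⟩
  · rw [lt_succ_iff_descInd_le hn hres, hturns]
    omega
  · rw [hfdef]
    simp only
    rw [residue_add_self, hWp]
    ring
  · simp [hfdef, hW0]
  · simp [hfdef, hW0]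
  · funext x
    rw [excess, hturns, residue_coe]
    omega

/-- A lift of `ν` is determined by its excess, which is an arbitrary function with the right sum. -/
noncomputable def liftEquivExcess (hn : 2 ≤ n) (k : ℕ) (ν : Equiv.Perm (Fin n)) :
    {f // IsLift n k ν f} ≃ {a : Fin n → ℕ // ∑ x, a x + cycDeg ν = k} :=
  Equiv.ofBijective (fun f => ⟨excess ν f.1, f.2.sum_excess hn⟩)
    ⟨fun f g h => Subtype.ext (f.2.ext_of_excess hn g.2 (congrArg Subtype.val h)), fun a => by
      obtain ⟨f, hf, h⟩ := exists_isLift_of_excess hn ν a.1 a.2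
      exact ⟨⟨f, hf⟩, Subtype.ext h⟩⟩

end lift

/-! ### Affine maps modulo M and the periods of 0. -/

/-- The sum `1 + k + ⋯ + k ^ (m - 1)`. -/
def geomNat (k m : ℕ) : ℕ := ∑ i ∈ Finset.range m, k ^ i

theorem geomNat_zero (k : ℕ) : geomNat k 0 = 0 := by simp [geomNat]

theorem geomNat_succ (k m : ℕ) : geomNat k (m + 1) = k * geomNat k m + 1 := geom_sum_succ

theorem geomNat_pos (k : ℕ) {m : ℕ} (hm : 0 < m) : 0 < geomNat k m := by
  obtain ⟨m, rfl⟩ := Nat.exists_eq_succ_of_ne_zero hm.ne'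
  rw [geomNat_succ]
  omega

theorem geomNat_one_left (m : ℕ) : geomNat 1 m = m := by simp [geomNat]

theorem sub_one_mul_geomNat (k m : ℕ) : ((k : ℤ) - 1) * geomNat k m = (k : ℤ) ^ m - 1 := by
  rw [geomNat]
  push_cast
  exact mul_geom_sum _ _

/-- The affine map `X ↦ k X + j` modulo `M`. -/
def affineMod (k M j : ℕ) (X : ZMod M) : ZMod M := k * X + j

theorem affineMod_iterate_zero (k M j m : ℕ) :
    (affineMod k M j)^[m] 0 = ((geomNat k m * j : ℕ) : ZMod M) := by
  induction m with
  | zero => simp [geomNat_zero]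
  | succ m ih =>
    rw [Function.iterate_succ_apply', ih, affineMod, geomNat_succ]
    push_cast
    ring

theorem isPeriodicPt_affineMod_iff {k M j m : ℕ} :
    Function.IsPeriodicPt (affineMod k M j) m 0 ↔ M ∣ geomNat k m * j := by
  rw [Function.IsPeriodicPt, Function.IsFixedPt, affineMod_iterate_zero, ZMod.natCast_eq_zero_iff]

/-! ### n-cycles as permutations with a single orbit. -/

section cycle

theorem mem_nCycles {n : ℕ} {ν : Equiv.Perm (Fin n)} : ν ∈ nCycles n ↔ ν.IsCycle ∧ ν.support = Finset.univ := by
  simp [nCycles]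

theorem apply_ne_of_mem_nCycles {n : ℕ} {ν : Equiv.Perm (Fin n)} (hν : ν ∈ nCycles n) (x : Fin n) : ν x ≠ x := by
  rw [← Equiv.Perm.mem_support, (mem_nCycles.1 hν).2]
  exact Finset.mem_univ x

theorem orderOf_of_mem_nCycles {n : ℕ} {ν : Equiv.Perm (Fin n)} (hν : ν ∈ nCycles n) : orderOf ν = n := by
  rw [(mem_nCycles.1 hν).1.orderOf, (mem_nCycles.1 hν).2, Finset.card_univ, Fintype.card_fin]

theorem dvd_of_pow_apply_eq_self {n : ℕ} {ν : Equiv.Perm (Fin n)} (hν : ν ∈ nCycles n) {x : Fin n}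
    {r : ℕ} (h : (ν ^ r) x = x) :
    n ∣ r := by
  have := ((mem_nCycles.1 hν).1.pow_eq_one_iff' (apply_ne_of_mem_nCycles hν x)).2 h
  rwa [← orderOf_dvd_iff_pow_eq_one, orderOf_of_mem_nCycles hν] at this

variable {n : ℕ} [NeZero n] {ν : Equiv.Perm (Fin n)}

theorem exists_pow_lt_eq_of_mem_nCycles (hν : ν ∈ nCycles n) (x y : Fin n) :
    ∃ m < n, (ν ^ m) x = y := by
  obtain ⟨m, hm⟩ := (mem_nCycles.1 hν).1.exists_pow_eq (apply_ne_of_mem_nCycles hν x)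
    (apply_ne_of_mem_nCycles hν y)
  refine ⟨m % n, Nat.mod_lt _ (Nat.pos_of_ne_zero (NeZero.ne n)), ?_⟩
  have := pow_mod_orderOf ν m
  rw [orderOf_of_mem_nCycles hν] at this
  rw [this, hm]

theorem mem_nCycles_of_forall_exists_pow (hn : 2 ≤ n) (x : Fin n)
    (h : ∀ y, ∃ m : ℕ, (ν ^ m) x = y) : ν ∈ nCycles n := by
  have hx : ν x ≠ x := by
    intro hx
    have hfix : ∀ y, y = x := fun y => by
      obtain ⟨m, rfl⟩ := h y
      exact Equiv.Perm.pow_apply_eq_self_of_apply_eq_self hx m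
    have h01 : (⟨0, by omega⟩ : Fin n) = ⟨1, by omega⟩ := (hfix _).trans (hfix _).symm
    simp at h01
  refine mem_nCycles.2 ⟨⟨x, hx, fun y _ => ?_⟩, ?_⟩
  · obtain ⟨m, rfl⟩ := h y
    exact ⟨m, by simp⟩
  · ext y
    simp only [Equiv.Perm.mem_support, Finset.mem_univ, iff_true]
    intro hy
    obtain ⟨m, rfl⟩ := h y
    rw [← Equiv.Perm.mul_apply, ← pow_succ', pow_succ, Equiv.Perm.mul_apply] at hy
    exact hx ((ν ^ m).injective hy)

end cycle

/-! ### Dynamics of a lift of an n-cycle. -/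

theorem StrictMono.sub_le_sub_int {g : ℤ → ℤ} (hg : StrictMono g) {x y : ℤ} (h : x ≤ y) :
    y - x ≤ g y - g x := by
  have : Monotone fun i => g i - i := monotone_int_of_le_succ fun i => by
    have := hg (show i < i + 1 by omega)
    omega
  have := this h
  simp only at this
  omega

namespace IsLift
variable {n k : ℕ} [NeZero n] {ν : Equiv.Perm (Fin n)} {f : ℤ → ℤ}

theorem map_add_mul (hf : IsLift n k ν f) (i q : ℤ) : f (i + n * q) = f i + n * (k * q) := by
  have h := Int.apply_eq_of_apply_succ_eq (G := fun q => f (i + n * q) - n * (k * q))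
    (fun q => by
      rw [show i + n * (q + 1) = i + n * q + n by ring, hf.map_add]
      ring) q
  simp only [mul_zero, add_zero, sub_zero] at h
  linarith

theorem iterate_add_mul (hf : IsLift n k ν f) (m : ℕ) (i q : ℤ) :
    f^[m] (i + n * q) = f^[m] i + n * (k ^ m * q) := by
  induction m with
  | zero => simp
  | succ m ih =>
    rw [Function.iterate_succ_apply', Function.iterate_succ_apply', ih, hf.map_add_mul]
    ring

theorem residue_iterate (hf : IsLift n k ν f) (m : ℕ) (i : ℤ) :
    residue n (f^[m] i) = (ν ^ m) (residue n i) := by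
  induction m with
  | zero => simp
  | succ m ih =>
    rw [Function.iterate_succ_apply', hf.residue_map, ih, pow_succ', Equiv.Perm.mul_apply]

theorem exists_orbit_eq (hf : IsLift n k ν f) (hν : ν ∈ nCycles n) (i a : ℤ) :
    ∃ m < n, ∃ q : ℤ, a = f^[m] i + n * q := by
  obtain ⟨m, hm, h⟩ := exists_pow_lt_eq_of_mem_nCycles hν (residue n i) (residue n a)
  rw [← hf.residue_iterate] at h
  exact ⟨m, hm, eq_add_mul_of_residue_eq h.symm⟩

/-- Induction from f(n g) = f 0 + n k g and f 0 < n: the bound n g is carried to n (k g + 1). -/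
theorem iterate_zero_le (hf : IsLift n k ν f) (m : ℕ) : f^[m] 0 ≤ n * geomNat k m := by
  induction m with
  | zero => simp [geomNat_zero]
  | succ m ih =>
    rw [Function.iterate_succ_apply', geomNat_succ]
    have h1 := hf.strictMono.monotone ih
    have h2 := hf.map_add_mul 0 (geomNat k m)
    have h3 := hf.zero_lt
    rw [zero_add] at h2
    push_cast
    nlinarith

theorem iterate_zero_lt (hf : IsLift n k ν f) {m : ℕ} (hm : 0 < m) :
    f^[m] 0 < n * geomNat k m := by
  obtain ⟨m, rfl⟩ := Nat.exists_eq_succ_of_ne_zero hm.ne'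
  rw [Function.iterate_succ_apply', geomNat_succ]
  have h1 := hf.strictMono.monotone (hf.iterate_zero_le m)
  have h2 := hf.map_add_mul 0 (geomNat k m)
  have h3 := hf.zero_lt
  rw [zero_add] at h2
  push_cast
  nlinarith

theorem iterate_zero_nonneg (hf : IsLift n k ν f) (m : ℕ) : 0 ≤ f^[m] 0 := by
  induction m with
  | zero => simp
  | succ m ih =>
    rw [Function.iterate_succ_apply']
    exact hf.zero_nonneg.trans (hf.strictMono.monotone ih)

/-- The rotation number of the orbit of `0`: the number of turns after `n` steps. -/
theorem exists_iterate_eq_mul (hf : IsLift n k ν f) (hν : ν ∈ nCycles n) :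
    ∃ j : ℕ, f^[n] 0 = n * j ∧ j < geomNat k n := by
  have hpos : (0 : ℤ) < n := cast_pos_of_neZero
  have h := hf.residue_iterate n 0
  have h1 : ν ^ n = 1 := by
    have := pow_orderOf_eq_one ν
    rwa [orderOf_of_mem_nCycles hν] at this
  rw [h1, Equiv.Perm.one_apply] at h
  obtain ⟨q, hq⟩ := eq_add_mul_of_residue_eq h
  have h2 := hf.iterate_zero_nonneg n
  have h3 := hf.iterate_zero_lt (Nat.pos_of_ne_zero (NeZero.ne n))
  rw [hq, zero_add] at h2 h3
  have h4 : 0 ≤ q := nonneg_of_mul_nonneg_right h2 hpos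
  have h5 : q < geomNat k n := lt_of_mul_lt_mul_left h3 hpos.le
  lift q to ℕ using h4
  exact ⟨q, by rw [hq, zero_add], by exact_mod_cast h5⟩

/-- Over a period, n steps of size at least 1 add up to n, so each of them is 1. -/
theorem eq_add_of_degree_one (hf : IsLift n 1 ν f) (i : ℤ) : f i = i + f 0 := by
  have hpos : (0 : ℤ) < n := cast_pos_of_neZero
  have h := Int.apply_eq_of_apply_succ_eq (G := fun i => f i - i) (fun i => by
    have h1 := hf.strictMono (show i < i + 1 by omega)
    have h2 := hf.strictMono.sub_le_sub_int (show i + 1 ≤ i + n by omega)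
    rw [hf.map_add] at h2
    push_cast at h2
    omega) i
  omega

/-- Makes f^n - id strictly increasing. Iteration never shrinks gaps, so a unit gap surviving n
steps is a unit gap throughout; the orbit meets every residue class, which would make f a
translation, of degree 1. -/
theorem add_one_lt_iterate (hf : IsLift n k ν f) (hν : ν ∈ nCycles n) (hk : 2 ≤ k) (a : ℤ) :
    f^[n] a + 1 < f^[n] (a + 1) := by
  have hpos : (0 : ℤ) < n := cast_pos_of_neZero
  by_contra hcon
  have hm : ∀ m ≤ n, f^[m] (a + 1) = f^[m] a + 1 := fun m hm => by
    obtain ⟨r, rfl⟩ : ∃ r, n = r + m := ⟨n - m, by omega⟩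
    rw [Function.iterate_add_apply, Function.iterate_add_apply] at hcon
    have h1 := (hf.strictMono.iterate m) (show a < a + 1 by omega)
    have h2 := (hf.strictMono.iterate r).sub_le_sub_int h1.le
    omega
  have hstep : ∀ i, f (i + 1) = f i + 1 := fun i => by
    obtain ⟨m, hmn, q, rfl⟩ := hf.exists_orbit_eq hν a i
    have h1 := hm (m + 1) hmn
    rw [Function.iterate_succ_apply', Function.iterate_succ_apply', hm m hmn.le] at h1
    rw [add_right_comm, hf.map_add_mul, hf.map_add_mul, h1]
    ring
  have h := Int.apply_eq_of_apply_succ_eq (G := fun i => f i - i) (fun i => by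
    rw [hstep]; ring) n
  have h2 := hf.map_add 0
  rw [zero_add] at h2
  simp only [h2] at h
  have : (2 : ℤ) ≤ k := by exact_mod_cast hk
  nlinarith

/-- Commuting the iterates gives f^n(f^m 0) = f^m(n j) = f^m 0 + n k^m j; the powers of k then
become geometric sums. -/
theorem iterate_sub_self (hf : IsLift n k ν f) {j : ℕ} (hj : f^[n] 0 = n * j) (m : ℕ) (q : ℤ) :
    f^[n] (f^[m] 0 + n * q) - (f^[m] 0 + n * q) =
      n * ((k - 1) * (geomNat k m * j + q * geomNat k n) + j) := by
  have h1 := hf.iterate_add_mul n (f^[m] 0) q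
  have h2 : f^[n] (f^[m] 0) = f^[m] 0 + n * (k ^ m * j) := by
    rw [← Function.iterate_add_apply, add_comm, Function.iterate_add_apply, hj,
      ← zero_add ((n : ℤ) * j), hf.iterate_add_mul]
  rw [h1, h2]
  linear_combination (-(n : ℤ) * j) * sub_one_mul_geomNat k m -
    (n : ℤ) * q * sub_one_mul_geomNat k n

theorem degree_pos (hf : IsLift n k ν f) : 0 < k := by
  have hpos : (0 : ℤ) < n := cast_pos_of_neZero
  have h := hf.strictMono (show (0 : ℤ) < 0 + n by omega)
  rw [hf.map_add] at h
  rcases Nat.eq_zero_or_pos k with rfl | hk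
  · simp at h
  · exact hk

/-- Up to an increasing change of variable, the orbit of `0` under a lift of an `n`-cycle is the
orbit of `0` under an affine map. -/
theorem exists_strictMono_orbit (hf : IsLift n k ν f) (hν : ν ∈ nCycles n) {j : ℕ}
    (hj : f^[n] 0 = n * j) : ∃ (θ : ℤ → ℤ) (c d : ℤ), StrictMono θ ∧ 0 < c ∧ ∀ (m : ℕ) (q : ℤ),
      θ (f^[m] 0 + n * q) = c * (geomNat k m * j + q * geomNat k n) + d := by
  have hpos : (0 : ℤ) < n := cast_pos_of_neZero
  have hk := hf.degree_pos
  rcases Nat.lt_or_ge 1 k with hk2 | hk1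
  · have hk3 : (0 : ℤ) < k - 1 := by
      have : (1 : ℤ) < k := by exact_mod_cast hk2
      linarith
    -- The displacement f^n - id serves as θ; it is constant when k = 1, where f is a translation
    -- and the identity is used instead.
    refine ⟨fun a => f^[n] a - a, n * (k - 1), n * j, strictMono_int_of_lt_succ fun a => ?_,
      mul_pos hpos hk3, fun m q => ?_⟩
    · have := hf.add_one_lt_iterate hν hk2 a
      omega
    · simp only
      rw [hf.iterate_sub_self hj]
      ring
  · obtain rfl : k = 1 := by omega
    have hit : ∀ m : ℕ, f^[m] 0 = m * f 0 := fun m => by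
      induction m with
      | zero => simp
      | succ m ih =>
        rw [Function.iterate_succ_apply', hf.eq_add_of_degree_one, ih]
        push_cast
        ring
    have hj' : f 0 = j := by
      rw [hit] at hj
      exact mul_left_cancel₀ hpos.ne' hj
    refine ⟨id, 1, 0, strictMono_id, one_pos, fun m q => ?_⟩
    simp only [hit, hj', geomNat_one_left, id]
    ring

theorem orbit_lt_iff (hf : IsLift n k ν f) (hν : ν ∈ nCycles n) {j : ℕ} (hj : f^[n] 0 = n * j)
    {m m' : ℕ} {q q' : ℤ} : f^[m] 0 + n * q < f^[m'] 0 + n * q' ↔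
    (geomNat k m * j + q * geomNat k n : ℤ) < geomNat k m' * j + q' * geomNat k n := by
  obtain ⟨θ, c, d, hθ, hc, h⟩ := hf.exists_strictMono_orbit hν hj
  rw [← hθ.lt_iff_lt, h, h, add_lt_add_iff_right, mul_lt_mul_iff_right₀ hc]

/-- If r is a period, some f^r 0 - n c has the same affine coordinate as 0, hence equals 0; then ν^r
fixes a point and n divides r. -/
theorem minimalPeriod_eq (hf : IsLift n k ν f) (hν : ν ∈ nCycles n) {j : ℕ}
    (hj : f^[n] 0 = n * j) :
    Function.minimalPeriod (affineMod k (geomNat k n) j) 0 = n := by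
  refine Nat.dvd_antisymm ?_ ?_
  · rw [← Function.isPeriodicPt_iff_minimalPeriod_dvd, isPeriodicPt_affineMod_iff]
    exact Dvd.intro _ rfl
  · set r := Function.minimalPeriod (affineMod k (geomNat k n) j) 0 with hr
    obtain ⟨c, hc⟩ := isPeriodicPt_affineMod_iff.1
      (Function.isPeriodicPt_minimalPeriod (affineMod k (geomNat k n) j) 0)
    rw [← hr] at hc
    have hX : (geomNat k r * j + (-c : ℤ) * geomNat k n : ℤ) =
        geomNat k 0 * j + 0 * geomNat k n := by
      rw [geomNat_zero]
      have : (geomNat k r * j : ℤ) = geomNat k n * c := by exact_mod_cast hc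
      rw [this]
      push_cast
      ring
    have h : f^[r] 0 + n * (-c : ℤ) = f^[0] 0 + n * 0 :=
      le_antisymm (not_lt.1 fun h => ((hf.orbit_lt_iff hν hj).1 h).ne' hX)
        (not_lt.1 fun h => ((hf.orbit_lt_iff hν hj).1 h).ne hX)
    have h2 := hf.residue_iterate r 0
    rw [← residue_add_mul _ (-c : ℤ), h] at h2
    simp only [Function.iterate_zero, id, mul_zero, add_zero] at h2
    exact dvd_of_pow_apply_eq_self hν h2.symm

end IsLift

/-! ### The bijection between lifts of n-cycles and affine maps. -/

/-- Two surjections onto `ℤ` that induce the same order and agree at one point are equal. -/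
theorem Int.eq_of_surjective_of_lt_iff {T : Type*} {Φ Ψ : T → ℤ} (hΦ : Function.Surjective Φ)
    (hΨ : Function.Surjective Ψ) (h : ∀ s t, Φ s < Φ t ↔ Ψ s < Ψ t) {t₀ : T} (h₀ : Φ t₀ = Ψ t₀) :
    Φ = Ψ := by
  have heq : ∀ s t, Φ s = Φ t → Ψ s = Ψ t := fun s t hst =>
    le_antisymm (not_lt.1 fun hlt => ((h _ _).2 hlt).ne' hst)
      (not_lt.1 fun hlt => ((h _ _).2 hlt).ne hst)
  obtain ⟨g, hg⟩ := hΦ.hasRightInverse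
  have hψ : ∀ t, Ψ (g (Φ t)) = Ψ t := fun t => heq _ _ (hg _)
  have hmono : StrictMono fun i => Ψ (g i) := fun i i' hi => by
    rw [← h, hg, hg]; exact hi
  -- Surjectivity of Ψ forbids the increasing map Ψ ∘ g to skip an integer, so it is a translation.
  have hsucc : ∀ i, Ψ (g (i + 1)) = Ψ (g i) + 1 := fun i => by
    have h1 := hmono (show i < i + 1 by omega)
    obtain ⟨t, ht⟩ := hΨ (Ψ (g i) + 1)
    have h2 : i < Φ t := by
      rw [← hmono.lt_iff_lt]
      simp only [hψ, ht]
      omega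
    have h3 := hmono.monotone (show i + 1 ≤ Φ t by omega)
    simp only [hψ, ht] at h1 h3
    omega
  have hsub := Int.apply_eq_of_apply_succ_eq (G := fun i => Ψ (g i) - i) (fun i => by
    rw [hsucc]; ring)
  funext t
  have h1 := hsub (Φ t)
  have h2 := hsub (Φ t₀)
  simp only [hψ] at h1 h2
  omega

section bijection
variable {n k : ℕ} [NeZero n]

/-- The labels (m, q) of the points f^m 0 + n q exhaust ℤ, and j determines their order; in labels,
f is (m, q) ↦ (m + 1, k q). -/
theorem IsLift.ext_of_iterate {ν ν' : Equiv.Perm (Fin n)} {f f' : ℤ → ℤ} (hf : IsLift n k ν f)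
    (hf' : IsLift n k ν' f') (hν : ν ∈ nCycles n) (hν' : ν' ∈ nCycles n) {j : ℕ}
    (hj : f^[n] 0 = n * j) (hj' : f'^[n] 0 = n * j) : f = f' := by
  have hsurj : ∀ {ν : Equiv.Perm (Fin n)} {f : ℤ → ℤ}, IsLift n k ν f → ν ∈ nCycles n →
      Function.Surjective fun p : ℕ × ℤ => f^[p.1] 0 + n * p.2 := fun hf hν a => by
    obtain ⟨m, -, q, h⟩ := hf.exists_orbit_eq hν 0 a
    exact ⟨(m, q), h.symm⟩
  have h := Int.eq_of_surjective_of_lt_iff (hsurj hf hν) (hsurj hf' hν') (t₀ := (0, 0))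
    (fun s t => (hf.orbit_lt_iff hν hj).trans (hf'.orbit_lt_iff hν' hj').symm) (by simp)
  funext a
  obtain ⟨⟨m, q⟩, rfl⟩ := hsurj hf hν a
  have h1 := congrFun h (m + 1, k * q)
  have h2 := congrFun h (m, q)
  simp only [Function.iterate_succ_apply'] at h1 h2 ⊢
  rw [hf.map_add_mul, h1, h2, hf'.map_add_mul]

theorem IsLift.perm_unique {ν ν' : Equiv.Perm (Fin n)} {f : ℤ → ℤ} (hf : IsLift n k ν f)
    (hf' : IsLift n k ν' f) : ν = ν' := by
  ext x
  rw [← residue_coe x, ← hf.residue_map, ← hf'.residue_map]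

/-- Increasing enumeration of a periodic set of integers. -/
theorem Int.exists_enumeration {M : ℤ} {T : Finset ℤ} (hT : ∀ t ∈ T, 0 ≤ t ∧ t < M)
    (h0 : 0 ∈ T) (hcard : T.card = n) : ∃ e : ℤ → ℤ, StrictMono e ∧ e 0 = 0 ∧
      (∀ i q, e (i + n * q) = e i + M * q) ∧ ∀ X, X % M ∈ T ↔ ∃ i, e i = X := by
  have hpos : (0 : ℤ) < n := cast_pos_of_neZero
  have hM : 0 < M := (hT 0 h0).2
  set o := T.orderEmbOfFin hcard with ho
  have hmem : ∀ x, o x ∈ T := fun x => T.orderEmbOfFin_mem hcard x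
  have hsurj : ∀ t ∈ T, ∃ x, o x = t := fun t ht => by
    have := T.range_orderEmbOfFin hcard
    rw [← ho] at this
    have h : t ∈ Set.range o := by rw [this]; exact ht
    exact h
  refine ⟨fun i => o (residue n i) + M * (i / n), fun i i' h => ?_, ?_, fun i q => ?_,
    fun X => ⟨fun hX => ?_, ?_⟩⟩
  · simp only
    have e1 := Int.mul_ediv_add_emod i n
    have e2 := Int.mul_ediv_add_emod i' n
    rcases (Int.ediv_le_ediv hpos h.le).lt_or_eq with hlt | heq
    · have h1 := (hT _ (hmem (residue n i))).2
      have h2 := (hT _ (hmem (residue n i'))).1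
      have h3 : i / n + 1 ≤ i' / n := hlt
      nlinarith
    · rw [heq] at e1 ⊢
      have : residue n i < residue n i' := by
        rw [Fin.lt_def]
        zify
        rw [coe_residue, coe_residue]
        omega
      have := o.strictMono this
      omega
  · obtain ⟨x, hx⟩ := hsurj 0 h0
    have h1 : o (residue n 0) ≤ o x := o.monotone (by
      rw [Fin.le_def]
      have := coe_residue (n := n) 0
      simp at this
      simp [this])
    have h2 := (hT _ (hmem (residue n 0))).1
    simp
    omega
  · simp only
    rw [residue_add_mul, Int.add_mul_ediv_left _ _ hpos.ne']
    ring
  · obtain ⟨x, hx⟩ := hsurj _ hX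
    refine ⟨(x : ℕ) + n * (X / M), ?_⟩
    have hx0 : ((x : ℕ) : ℤ) / n = 0 :=
      Int.ediv_eq_zero_of_lt (by positivity) (by exact_mod_cast x.2)
    simp only
    rw [residue_add_mul, residue_coe, hx, Int.add_mul_ediv_left _ _ hpos.ne', hx0, zero_add]
    have := Int.mul_ediv_add_emod X M
    linarith
  · rintro ⟨i, rfl⟩
    rw [Int.add_mul_emod_self_left, Int.emod_eq_of_lt (hT _ (hmem _)).1 (hT _ (hmem _)).2]
    exact hmem _

/-- The integers whose class modulo M lies in the orbit of 0 are stable under X ↦ k X + j.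
Enumerating them increasingly by e, with e 0 = 0, and conjugating the affine map by e yields f. -/
theorem exists_isLift_of_minimalPeriod (hn : 2 ≤ n) (hk : 1 ≤ k) {j : ℕ} (hjM : j < geomNat k n)
    (hper : Function.minimalPeriod (affineMod k (geomNat k n) j) 0 = n) :
    ∃ ν ∈ nCycles n, ∃ f, IsLift n k ν f ∧ f^[n] 0 = n * j := by
  have hpos : 0 < n := Nat.pos_of_ne_zero (NeZero.ne n)
  have hMpos : 0 < geomNat k n := geomNat_pos k hpos
  set M := geomNat k n with hM
  set F := affineMod k M j with hF
  have hMZ : (0 : ℤ) < M := by exact_mod_cast hMpos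
  set T : Finset ℤ := (Finset.range n).image fun m => ((geomNat k m * j : ℕ) : ℤ) % M with hTdef
  have hcast : ∀ (X : ℤ) (m : ℕ),
      (X : ZMod M) = F^[m] 0 ↔ X % M = ((geomNat k m * j : ℕ) : ℤ) % M := fun X m => by
    rw [hF, affineMod_iterate_zero, ← Int.cast_natCast, ZMod.intCast_eq_intCast_iff]
    rfl
  have hTmem : ∀ X : ℤ, X % M ∈ T ↔ ∃ m : ℕ, (X : ZMod M) = F^[m] 0 := fun X => by
    simp only [hTdef, Finset.mem_image, Finset.mem_range]
    constructor
    · rintro ⟨m, -, h⟩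
      exact ⟨m, (hcast X m).2 h.symm⟩
    · rintro ⟨m, h⟩
      refine ⟨m % n, Nat.mod_lt _ hpos, ((hcast X _).1 ?_).symm⟩
      have := Function.iterate_mod_minimalPeriod_eq (f := F) (x := 0) (n := m)
      rw [hper] at this
      rw [this, h]
  have hT : ∀ t ∈ T, 0 ≤ t ∧ t < M := fun t ht => by
    obtain ⟨m, -, rfl⟩ := Finset.mem_image.1 ht
    exact ⟨Int.emod_nonneg _ hMZ.ne', Int.emod_lt_of_pos _ hMZ⟩
  have h0 : (0 : ℤ) ∈ T := by
    have := (hTmem 0).2 ⟨0, by simp⟩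
    simpa using this
  have hcard : T.card = n := by
    rw [hTdef, Finset.card_image_of_injOn, Finset.card_range]
    intro m hm m' hm' h
    refine Function.iterate_injOn_Iio_minimalPeriod (f := F) (x := 0) ?_ ?_
      (((hcast _ m).2 rfl).symm.trans ((hcast ((geomNat k m * j : ℕ) : ℤ) m').2 h))
    · simpa [hper] using hm
    · simpa [hper] using hm'
  obtain ⟨e, hmono, he0, hadd, hrange⟩ := Int.exists_enumeration hT h0 hcard
  have hrange' : ∀ X : ℤ, (∃ i, e i = X) ↔ ∃ m : ℕ, (X : ZMod M) = F^[m] 0 := fun X => by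
    rw [← hrange, hTmem]
  have hex : ∀ i, ∃ i', e i' = k * e i + j := fun i => by
    obtain ⟨m, hm⟩ := (hrange' (e i)).1 ⟨i, rfl⟩
    refine (hrange' _).2 ⟨m + 1, ?_⟩
    rw [Function.iterate_succ_apply', ← hm, hF, affineMod]
    push_cast
    rfl
  choose f hf using hex
  have hkZ : (0 : ℤ) < k := by exact_mod_cast hk
  have hfadd : ∀ i q, f (i + n * q) = f i + n * (k * q) := fun i q => hmono.injective (by
    rw [hf, hadd, hadd, hf]; ring)
  have hfmono : StrictMono f := fun i i' h => by
    rw [← hmono.lt_iff_lt, hf, hf]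
    have := mul_lt_mul_of_pos_left (hmono h) hkZ
    linarith
  have hiter : ∀ m : ℕ, e (f^[m] 0) = (geomNat k m * j : ℕ) := fun m => by
    induction m with
    | zero => simp [he0, geomNat_zero]
    | succ m ih =>
      rw [Function.iterate_succ_apply', hf, ih, geomNat_succ]
      push_cast
      ring
  have hres : ∀ i i' : ℤ, residue n i = residue n i' → residue n (f i) = residue n (f i') :=
    fun i i' h => by
      obtain ⟨q, rfl⟩ := eq_add_mul_of_residue_eq h
      rw [hfadd, residue_add_mul]
  have horbit : ∀ y : Fin n, ∃ m : ℕ, residue n (f^[m + 1] 0) = y := fun y => by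
    obtain ⟨m, hm⟩ := (hrange' (e (y : ℕ))).1 ⟨_, rfl⟩
    -- Adding a full period makes the exponent positive, so that y is seen in the image of f.
    have h1 : ((e (y : ℕ) : ℤ) : ZMod M) = F^[m + (n - 1) + 1] 0 := by
      rw [hm, show m + (n - 1) + 1 = m + n by omega, Function.iterate_add_apply]
      congr 1
      have := Function.iterate_minimalPeriod (f := F) (x := 0)
      rw [hper] at this
      exact this.symm
    refine ⟨m + (n - 1), ?_⟩
    rw [hcast, ← hiter] at h1
    obtain ⟨c, hc⟩ := Int.ModEq.dvd (show e (y : ℕ) ≡ _ [ZMOD M] from h1)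
    have h2 : f^[m + (n - 1) + 1] 0 = (y : ℕ) + n * c := hmono.injective (by
      rw [hadd]; linarith)
    rw [h2, residue_add_mul, residue_coe]
  have hsurj : Function.Surjective fun x : Fin n => residue n (f (x : ℕ)) := fun y => by
    obtain ⟨m, hm⟩ := horbit y
    refine ⟨residue n (f^[m] 0), ?_⟩
    rw [← hm, Function.iterate_succ_apply']
    exact hres _ _ (residue_coe _)
  set ν : Equiv.Perm (Fin n) := Equiv.ofBijective _ (Finite.surjective_iff_bijective.1 hsurj)
    with hνdef
  -- Since e (f 0) = j, e 0 = 0 and e n = M, the normalization 0 ≤ f 0 < n amounts to 0 ≤ j < M.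
  have hjZ : (j : ℤ) < M := by exact_mod_cast hjM
  have hlift : IsLift n k ν f := by
    refine ⟨hfmono, fun i => ?_, ?_, ?_, fun i => ?_⟩
    · have := hfadd i 1
      rw [mul_one, mul_one] at this
      rw [this, mul_comm]
    · rw [← hmono.le_iff_le, hf, he0]
      simp
    · have h1 := hadd 0 1
      rw [← hmono.lt_iff_lt, hf]
      rw [zero_add, mul_one] at h1
      rw [h1, he0]
      simpa using hjZ
    · exact hres _ _ (residue_coe _).symm
  refine ⟨ν, mem_nCycles_of_forall_exists_pow hn (residue n 0) fun y => ?_, f, hlift, ?_⟩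
  · obtain ⟨m, hm⟩ := horbit y
    exact ⟨m + 1, by rw [← hlift.residue_iterate, hm]⟩
  · refine hmono.injective ?_
    have h1 := hadd 0 j
    rw [zero_add] at h1
    rw [hiter, h1, he0]
    push_cast
    ring

/-- The lifts of degree `k` of the `n`-cycles correspond to the affine maps of slope `k` for which
`0` has period exactly `n`. -/
theorem card_sigma_isLift (hn : 2 ≤ n) (hk : 1 ≤ k) :
    Nat.card (Σ ν : {ν // ν ∈ nCycles n}, {f // IsLift n k ν.1 f}) =
      Nat.card {j : ℕ // j < geomNat k n ∧
        Function.minimalPeriod (affineMod k (geomNat k n) j) 0 = n} := by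
  choose J hJ using fun p : Σ ν : {ν // ν ∈ nCycles n}, {f // IsLift n k ν.1 f} =>
    p.2.2.exists_iterate_eq_mul p.1.2
  refine Nat.card_congr (Equiv.ofBijective
    (fun p => ⟨J p, (hJ p).2, p.2.2.minimalPeriod_eq p.1.2 (hJ p).1⟩) ⟨fun p p' h => ?_, ?_⟩)
  · have hjj : J p = J p' := congrArg Subtype.val h
    have h1 := (hJ p).1
    have h2 := (hJ p').1
    rw [hjj] at h1
    obtain ⟨⟨ν, hν⟩, ⟨f, hf⟩⟩ := p
    obtain ⟨⟨ν', hν'⟩, ⟨f', hf'⟩⟩ := p'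
    obtain rfl : f = f' := hf.ext_of_iterate hf' hν hν' h1 h2
    obtain rfl : ν = ν' := hf.perm_unique hf'
    rfl
  · rintro ⟨j, hjM, hper⟩
    obtain ⟨ν, hν, f, hf, hj⟩ := exists_isLift_of_minimalPeriod hn hk hjM hper
    refine ⟨⟨⟨ν, hν⟩, ⟨f, hf⟩⟩, Subtype.ext ?_⟩
    have h1 := (hJ ⟨⟨ν, hν⟩, ⟨f, hf⟩⟩).1
    simp only [hj] at h1
    have h2 := mul_left_cancel₀ (cast_pos_of_neZero (n := n)).ne' h1
    exact_mod_cast h2.symm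

end bijection

/-! ### Counting by exact period and Möbius inversion. -/

open Finset in
/-- The number of `j` below `1 + k + ⋯ + k ^ (n - 1)` for which `0` has period exactly `n` under
the map `X ↦ k X + j`. -/
noncomputable def primitiveCount (k n : ℕ) : ℕ :=
  #{j ∈ range (geomNat k n) | Function.minimalPeriod (affineMod k (geomNat k n) j) 0 = n}

theorem geomNat_dvd (k : ℕ) {r n : ℕ} (h : r ∣ n) : geomNat k r ∣ geomNat k n := by
  obtain ⟨c, rfl⟩ := h
  have : ∀ m, geomNat k (r + m) = geomNat k r + k ^ r * geomNat k m := fun m => by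
    simp only [geomNat]
    rw [Finset.sum_range_add, Finset.mul_sum]
    simp only [pow_add]
  induction c with
  | zero => simp [geomNat_zero]
  | succ c ih =>
    rw [mul_add, mul_one, add_comm, this]
    exact dvd_add dvd_rfl (ih.mul_left _)

theorem minimalPeriod_affineMod_mul {k M c j : ℕ} (hc : 0 < c) :
    Function.minimalPeriod (affineMod k (c * M) (c * j)) 0 =
      Function.minimalPeriod (affineMod k M j) 0 := by
  have h : ∀ m, Function.IsPeriodicPt (affineMod k (c * M) (c * j)) m 0 ↔
      Function.IsPeriodicPt (affineMod k M j) m 0 := fun m => by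
    rw [isPeriodicPt_affineMod_iff, isPeriodicPt_affineMod_iff, mul_left_comm,
      Nat.mul_dvd_mul_iff_left hc]
  refine Nat.dvd_antisymm ?_ ?_
  · rw [← Function.isPeriodicPt_iff_minimalPeriod_dvd, h]
    exact Function.isPeriodicPt_minimalPeriod _ _
  · rw [← Function.isPeriodicPt_iff_minimalPeriod_dvd, ← h]
    exact Function.isPeriodicPt_minimalPeriod _ _

open Finset in
-- With c = `geomNat k n / geomNat k r`, a period r forces c to divide j, and dividing j and the
-- modulus by c preserves periods.
theorem card_minimalPeriod_eq (k : ℕ) {r n : ℕ} (hn : 0 < n) (h : r ∣ n) :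
    #{j ∈ range (geomNat k n) | Function.minimalPeriod (affineMod k (geomNat k n) j) 0 = r} =
      primitiveCount k r := by
  have hr : 0 < geomNat k r := geomNat_pos k (Nat.pos_of_dvd_of_pos h hn)
  obtain ⟨c, hc⟩ := geomNat_dvd k h
  rw [mul_comm] at hc
  have hcpos : 0 < c := by
    have := geomNat_pos k hn
    rw [hc] at this
    exact Nat.pos_of_mul_pos_right this
  symm
  rw [primitiveCount, hc]
  refine card_bij (fun j _ => c * j) (fun j hj => ?_) (fun i _ j _ hij => ?_) (fun j hj => ?_)
  · rw [mem_filter, mem_range] at hj ⊢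
    rw [minimalPeriod_affineMod_mul hcpos]
    exact ⟨Nat.mul_lt_mul_of_pos_left hj.1 hcpos, hj.2⟩
  · exact Nat.eq_of_mul_eq_mul_left hcpos hij
  · rw [mem_filter, mem_range] at hj
    have h1 := Function.isPeriodicPt_minimalPeriod (affineMod k (c * geomNat k r) j) 0
    rw [hj.2, isPeriodicPt_affineMod_iff, mul_comm, Nat.mul_dvd_mul_iff_left hr] at h1
    obtain ⟨i, rfl⟩ := h1
    refine ⟨i, ?_, rfl⟩
    rw [mem_filter, mem_range]
    rw [minimalPeriod_affineMod_mul hcpos] at hj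
    exact ⟨Nat.lt_of_mul_lt_mul_left hj.1, hj.2⟩

theorem sum_primitiveCount (k : ℕ) {n : ℕ} (hn : 0 < n) :
    ∑ r ∈ n.divisors, primitiveCount k r = geomNat k n := by
  have h := Finset.card_eq_sum_card_fiberwise (s := Finset.range (geomNat k n)) (t := n.divisors)
    (f := fun j => Function.minimalPeriod (affineMod k (geomNat k n) j) 0) (fun j _ => by
      simp only [Finset.mem_coe, Nat.mem_divisors]
      refine ⟨?_, hn.ne'⟩
      rw [← Function.isPeriodicPt_iff_minimalPeriod_dvd, isPeriodicPt_affineMod_iff]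
      exact Dvd.intro _ rfl)
  rw [Finset.card_range] at h
  rw [h]
  exact Finset.sum_congr rfl fun r hr =>
    (card_minimalPeriod_eq k hn (Nat.dvd_of_mem_divisors hr)).symm

theorem cycDelta_eq_primitiveCount (k : ℕ) {n : ℕ} (hn : 0 < n) :
    cycDelta n k = primitiveCount k n := by
  have h := (ArithmeticFunction.sum_eq_iff_sum_mul_moebius_eq (R := ℤ)
    (f := fun n => (primitiveCount k n : ℤ)) (g := fun n => (geomNat k n : ℤ))).1
    (fun n hn => by exact_mod_cast sum_primitiveCount k hn) n hn
  rw [← h, ← Nat.map_div_left_divisors, Finset.sum_map]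
  simp only [cycDelta, geomNat, Nat.cast_sum, Nat.cast_pow, Int.cast_id]
  rfl

theorem card_sigma_isLift_eq_cycDelta {n k : ℕ} [NeZero n] (hn : 2 ≤ n) (hk : 1 ≤ k) :
    (Nat.card (Σ ν : {ν // ν ∈ nCycles n}, {f // IsLift n k ν.1 f}) : ℤ) = cycDelta n k := by
  rw [card_sigma_isLift hn hk, cycDelta_eq_primitiveCount k (by omega), primitiveCount]
  congr 1
  exact Nat.subtype_card _ fun j => by rw [Finset.mem_filter, Finset.mem_range]

/-- For k = 0 the modulus is 1, so the period is 1 rather than n. This is why the final sum may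
start at i = 1. -/
theorem cycDelta_zero_right {n : ℕ} (hn : 2 ≤ n) : cycDelta n 0 = 0 := by
  rw [cycDelta_eq_primitiveCount 0 (by omega), primitiveCount, Nat.cast_eq_zero,
    Finset.card_eq_zero, Finset.filter_eq_empty_iff]
  intro j _ h
  have h1 : geomNat 0 n = 1 := by
    obtain ⟨m, rfl⟩ := Nat.exists_eq_succ_of_ne_zero (show n ≠ 0 by omega)
    rw [geomNat_succ, zero_mul]
  have h2 : Function.IsPeriodicPt (affineMod 0 (geomNat 0 n) j) 1 0 := by
    rw [isPeriodicPt_affineMod_iff, h1]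
    exact one_dvd _
  rw [Function.isPeriodicPt_iff_minimalPeriod_dvd, h] at h2
  have := Nat.le_of_dvd one_pos h2
  omega

/-! ### Generating functions. -/

theorem finite_sum_add_eq (n d k : ℕ) : Finite {a : Fin n → ℕ // ∑ x, a x + d = k} := by
  refine Set.Finite.subset (Finset.finite_toSet (Finset.piAntidiag Finset.univ (k - d))) ?_
  intro a ha
  have h : ∑ x, a x + d = k := ha
  rw [Finset.mem_coe, Finset.mem_piAntidiag]
  exact ⟨(Nat.sub_eq_of_eq_add h.symm).symm, fun i _ => Finset.mem_univ i⟩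

/-- `PowerSeries.mk 1` is 1 / (1 - X), so its nth power counts the possible excesses. -/
theorem coeff_mk_one_pow_eq_card (n t : ℕ) :
    PowerSeries.coeff t ((PowerSeries.mk 1 : PowerSeries ℤ) ^ n) =
      Nat.card {a : Fin n → ℕ // ∑ x, a x = t} := by
  have h := PowerSeries.coeff_prod (fun _ : Fin n => (PowerSeries.mk 1 : PowerSeries ℤ)) t
    Finset.univ
  rw [Finset.prod_const, Finset.card_univ, Fintype.card_fin] at h
  rw [h]
  simp only [PowerSeries.coeff_mk, Pi.one_apply, Finset.prod_const_one, Finset.sum_const,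
    nsmul_eq_mul, mul_one]
  congr 1
  rw [← Nat.subtype_card (p := fun g : Fin n →₀ ℕ => ∑ x, g x = t) _ (fun g => by
    rw [Finset.mem_finsuppAntidiag]
    simp)]
  exact Nat.card_congr (Finsupp.equivFunOnFinite.subtypeEquiv fun g => Iff.rfl)

theorem card_sum_add_eq_coeff (n d k : ℕ) :
    (Nat.card {a : Fin n → ℕ // ∑ x, a x + d = k} : ℤ) =
      PowerSeries.coeff k (PowerSeries.X ^ d * (PowerSeries.mk 1 : PowerSeries ℤ) ^ n) := by
  rw [PowerSeries.coeff_X_pow_mul']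
  split_ifs with h
  · rw [coeff_mk_one_pow_eq_card]
    congr 1
    exact Nat.card_congr (Equiv.subtypeEquivRight fun a => by omega)
  · rw [Nat.cast_eq_zero]
    have : IsEmpty {a : Fin n → ℕ // ∑ x, a x + d = k} := ⟨fun a => h (by have := a.2; omega)⟩
    exact Nat.card_of_isEmpty

theorem PowerSeries.coeff_one_sub_X_pow (n m : ℕ) :
    PowerSeries.coeff m ((1 - PowerSeries.X : PowerSeries ℤ) ^ n) = (-1) ^ m * n.choose m := by
  have h1 : PowerSeries.rescale (-1 : ℤ) (((1 + Polynomial.X : Polynomial ℤ) ^ n :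
      Polynomial ℤ) : PowerSeries ℤ) = (1 - PowerSeries.X) ^ n := by
    rw [Polynomial.coe_pow, map_pow, Polynomial.coe_add, map_add, Polynomial.coe_one, map_one,
      Polynomial.coe_X, PowerSeries.rescale_X]
    simp [sub_eq_add_neg]
  rw [← h1, PowerSeries.coeff_rescale, Polynomial.coeff_coe, Polynomial.coeff_one_add_X_pow]

/-- The generating function of `cycDelta n` in terms of the degrees of the `n`-cycles. -/
theorem mk_cycDelta {n : ℕ} (hn : 2 ≤ n) :
    (PowerSeries.mk fun k => cycDelta n k) =
      (∑ ν ∈ nCycles n, PowerSeries.X ^ cycDeg ν) * (PowerSeries.mk 1 : PowerSeries ℤ) ^ n := by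
  have : NeZero n := ⟨by omega⟩
  ext k
  rw [PowerSeries.coeff_mk, Finset.sum_mul, map_sum]
  simp only [← card_sum_add_eq_coeff]
  have hfin : ∀ ν : Equiv.Perm (Fin n), Finite {f // IsLift n k ν f} := fun ν =>
    have := finite_sum_add_eq n (cycDeg ν) k
    Finite.of_equiv _ (liftEquivExcess hn k ν).symm
  have hsum : ∑ ν ∈ nCycles n, (Nat.card {a : Fin n → ℕ // ∑ x, a x + cycDeg ν = k} : ℤ) =
      Nat.card (Σ ν : {ν // ν ∈ nCycles n}, {f // IsLift n k ν.1 f}) := by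
    rw [Nat.card_sigma, ← Finset.sum_coe_sort]
    push_cast
    exact Finset.sum_congr rfl fun ν _ => by rw [Nat.card_congr (liftEquivExcess hn k ν.1)]
  rw [hsum]
  rcases Nat.eq_zero_or_pos k with rfl | hk
  · have : IsEmpty (Σ ν : {ν // ν ∈ nCycles n}, {f // IsLift n 0 ν.1 f}) :=
      ⟨fun p => absurd p.2.2.degree_pos (lt_irrefl 0)⟩
    rw [cycDelta_zero_right hn, Nat.card_of_isEmpty, Nat.cast_zero]
  · exact (card_sigma_isLift_eq_cycDelta hn hk).symm

theorem numCyclesOfDeg_eq {n : ℕ} (hn : 2 ≤ n) (d : ℕ) :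
    (numCyclesOfDeg n d : ℤ) =
      ∑ i ∈ Finset.Icc 1 d, (-1 : ℤ) ^ (d - i) * (n.choose (d - i) : ℤ) * cycDelta n i := by
  have h : (1 - PowerSeries.X) ^ n * (PowerSeries.mk fun k => cycDelta n k) =
      ∑ ν ∈ nCycles n, PowerSeries.X ^ cycDeg ν := by
    rw [mk_cycDelta hn, mul_left_comm, ← mul_pow, mul_comm (1 - PowerSeries.X),
      PowerSeries.mk_one_mul_one_sub_eq_one, one_pow, mul_one]
  have h1 := congrArg (PowerSeries.coeff d) h
  rw [map_sum] at h1
  simp only [PowerSeries.coeff_X_pow] at h1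
  rw [← Finset.natCast_card_filter] at h1
  rw [numCyclesOfDeg]
  simp only [eq_comm (b := d)]
  rw [← h1, mul_comm, PowerSeries.coeff_mul, Finset.Nat.sum_antidiagonal_eq_sum_range_succ_mk,
    Finset.range_eq_Ico, Finset.sum_eq_sum_Ico_succ_bot (Nat.succ_pos d)]
  simp only [PowerSeries.coeff_mk, cycDelta_zero_right hn, zero_mul, zero_add]
  refine Finset.sum_congr (by ext; simp) fun i _ => ?_
  rw [PowerSeries.coeff_one_sub_X_pow, mul_comm]

/-! ### Vanishing in degrees at least n - 1, by reversal of values. -/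

theorem rev_residue {n : ℕ} [NeZero n] (i : ℤ) : (residue n i).rev = residue n (-1 - i) := by
  have hpos : (0 : ℤ) < n := cast_pos_of_neZero
  have hlt := (residue n i).2
  have h : (((residue n i).rev : ℕ) : ℤ) = (residue n (-1 - i) : ℕ) := by
    rw [coe_residue, Fin.val_rev, Nat.cast_sub (by omega)]
    push_cast
    rw [coe_residue]
    have h1 := Int.emod_nonneg i hpos.ne'
    have h2 := Int.emod_lt_of_pos i hpos
    have h3 := Int.mul_ediv_add_emod i n
    have h4 : -1 - i = (n - (i % n + 1)) + n * (-1 - i / n) := by linarith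
    generalize i % (n : ℤ) = r at *
    rw [h4, Int.add_mul_emod_self_left, Int.emod_eq_of_lt (by omega) (by omega)]
  exact Fin.ext (by exact_mod_cast h)

theorem cycDeg_add_cycDeg_rev {n : ℕ} (hn : 2 ≤ n) (ν : Equiv.Perm (Fin n)) :
    cycDeg ν + cycDeg (ν.trans Fin.revPerm) = n := by
  have : NeZero n := ⟨by omega⟩
  rw [cycDeg_eq_sum, cycDeg_eq_sum, ← Finset.sum_add_distrib]
  have h : ∀ x, descInd ν x + descInd (ν.trans Fin.revPerm) x = 1 := fun x => by
    have hne : ν (finRotate n x) ≠ ν x := fun h => by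
      have h1 := ν.injective h
      rw [← residue_coe x, finRotate_residue] at h1
      exact residue_succ_ne hn _ h1
    unfold descInd
    simp only [Equiv.trans_apply, Fin.revPerm_apply, Fin.rev_lt_rev]
    rcases lt_or_gt_of_ne hne with h | h
    · rw [if_pos h, if_neg h.asymm]
    · rw [if_neg h.asymm, if_pos h]
  simp [h]

theorem cycDeg_lt_of_mem_nCycles {n : ℕ} (hn : 3 ≤ n) {ν : Equiv.Perm (Fin n)}
    (hν : ν ∈ nCycles n) : cycDeg ν < n - 1 := by
  have : NeZero n := ⟨by omega⟩
  by_contra hd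
  have hrev := cycDeg_add_cycDeg_rev (by omega) ν
  -- The reversed permutation has degree at most 1; putting the missing turn, if any, at 0 gives it
  -- a lift of degree 1, which is a translation.
  obtain ⟨f, hf, -⟩ := exists_isLift_of_excess (k := 1) (by omega) (ν.trans Fin.revPerm)
    (Pi.single 0 (1 - cycDeg (ν.trans Fin.revPerm))) (by
      rw [Finset.sum_pi_single']
      simp
      omega)
  have hmap : ∀ i, ν (residue n i) = residue n (-1 - (i + f 0)) := fun i => by
    rw [← rev_residue, ← hf.eq_add_of_degree_one, hf.residue_map]
    simp
  have h2 : (ν ^ 2) (residue n 0) = residue n 0 := by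
    rw [pow_two, Equiv.Perm.mul_apply, hmap, hmap]
    congr 1
    ring
  have := Nat.le_of_dvd two_pos (dvd_of_pow_apply_eq_self hν h2)
  omega

theorem numCyclesOfDeg_eq_zero {n d : ℕ} (hn : 3 ≤ n) (hd : n - 1 ≤ d) :
    numCyclesOfDeg n d = 0 := by
  rw [numCyclesOfDeg, Finset.card_eq_zero, Finset.filter_eq_empty_iff]
  intro ν hν h
  have := cycDeg_lt_of_mem_nCycles hn hν
  omega

theorem mainTheorem1 (n : ℕ) (hn : 2 ≤ n) :
    (∀ d : ℕ, 1 ≤ d →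
      (numCyclesOfDeg n d : ℤ) =
        ∑ i ∈ Finset.Icc 1 d, (-1 : ℤ) ^ (d - i) * (n.choose (d - i) : ℤ) * cycDelta n i) ∧
    (3 ≤ n → ∀ d : ℕ, n - 1 ≤ d →
      ∑ i ∈ Finset.Icc 1 d, (-1 : ℤ) ^ (d - i) * (n.choose (d - i) : ℤ) * cycDelta n i = 0) := by
  refine ⟨fun d _ => numCyclesOfDeg_eq hn d, fun hn3 d hd => ?_⟩
  rw [← numCyclesOfDeg_eq hn, numCyclesOfDeg_eq_zero hn3 hd, Nat.cast_zero]
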